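/- Let $\mathbb K$ be a field, $\ell\ge 0$ an integer, $S=\mathbb K[x_1,\dots,x_\ell]$ the coordinate ring of $V=\mathbb K^\ell$, and $\operatorname{Der}S=\bigoplus_{i=1}^{\ell}S\,\partial_{x_i}$, graded so that $\sum_i f_i\partial_{x_i}$ is homogeneous of degree $d$ when all $f_i$ are homogeneous of degree $d$. A hyperplane arrangement $\mathcal A$ in $V$ is a finite set of hyperplanes $H=\{\alpha_H=0\}$ with $0\neq\alpha_H\in V^*$, and its logarithmic derivation module is the graded $S$-module $$D(\mathcal A)=\{\theta\in\operatorname{Der}S\mid \theta(\alpha_H)\in S\alpha_H\ \text{ for all } H\in\mathcal A\}.$$ $\mathcal A$ is free if $D(\mathcal A)\simeq\bigoplus_{i=1}^{\ell}S[-d_i]$ as graded modules for some $d_1,\dots,d_\ell$, i.e. if $D(\mathcal A)$ has a basis of $\ell$ homogeneous elements. Let $g(\mathcal A)$ be the cardinality of a minimal set of homogeneous generators of $D(\mathcal A)$ (it does not depend on the choice of this set). $\mathcal A$ is SPOG (strictly plus-one generated) if for some $d_1=1,d_2,\dots,d_\ell$ and $d$ there is a minimal graded free resolution $$0\to S[-d-1]\to\Big(\bigoplus_{i=1}^{\ell}S[-d_i]\Big)\oplus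 S[-d]\to D(\mathcal A)\to 0$$ in which the generator of degree $d_1=1$ is mapped to the Euler derivation $\theta_E=\sum_i x_i\partial_{x_i}$ and the component $S[-d-1]\to S[-d]$ of the first map is multiplication by a non-zero linear form. Let $\mathcal A$ be a hyperplane arrangement in $\mathbb K^\ell$, $H\in\mathcal A$ and $\mathcal A'=\mathcal A\setminus\{H\}$. If $\mathcal A'$ is free and $g(\mathcal A)=\ell+1$, then $\mathcal A$ is SPOG. -/

import Mathlib

open MvPolynomial

noncomputable section

namespace HypArr

/-- The coordinate ring `S = K[x_1, …, x_ℓ]` of `V = K^ℓ`. -/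
abbrev CoordRing (K : Type*) [Field K] (ℓ : ℕ) : Type _ := MvPolynomial (Fin ℓ) K

/-- The module `Der S` of `K`-linear derivations of `S`; it is free with basis `∂/∂x_i`. -/
abbrev Der (K : Type*) [Field K] (ℓ : ℕ) : Type _ :=
  Derivation K (CoordRing K ℓ) (CoordRing K ℓ)

/-- A linear form on `V = K^ℓ`, as an element of the degree-one part `V^*` of `S`. -/
def linearPoly {K : Type*} [Field K] {ℓ : ℕ} (α : Module.Dual K (Fin ℓ → K)) : CoordRing K ℓ :=
  ∑ i, C (α (Pi.single i 1)) * X i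

/-- A (central) hyperplane arrangement in `K^ℓ`: a finite set of hyperplanes, each of which is the
zero locus of a non-zero linear form. -/
structure Arrangement (K : Type*) [Field K] (ℓ : ℕ) where
  hyperplanes : Set (Submodule K (Fin ℓ → K))
  finite : hyperplanes.Finite
  isHyperplane : ∀ H ∈ hyperplanes, ∃ α : Module.Dual K (Fin ℓ → K), α ≠ 0 ∧ H = LinearMap.ker α

/-- The homogeneous derivations of polynomial degree `d`: those `θ = ∑ f_i ∂/∂x_i` all of whose
coefficients `f_i = θ(x_i)` are homogeneous of degree `d`. -/
def IsHomogeneousDer {K : Type*} [Field K] {ℓ : ℕ} (θ : Der K ℓ) (d : ℕ) : Prop :=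
  ∀ i, (θ (X i)).IsHomogeneous d

/-- The Euler derivation `θ_E = ∑ x_i ∂/∂x_i`. -/
def eulerDer (K : Type*) [Field K] (ℓ : ℕ) : Der K ℓ :=
  mkDerivation K (fun i => X i)

/-- `p` lies in the degree-`n` part of the shifted graded module `S[-a]`, that is,
in `S_{n-a}`, which is zero when `n < a`. -/
def InShiftedDegree {K : Type*} [Field K] {ℓ : ℕ} (a n : ℕ) (p : CoordRing K ℓ) : Prop :=
  p = 0 ∨ (a ≤ n ∧ p.IsHomogeneous (n - a))

namespace Arrangement

variable {K : Type*} [Field K] {ℓ : ℕ}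

/-- The deletion `A \ {H}`. -/
def delete (A : Arrangement K ℓ) (H : Submodule K (Fin ℓ → K)) : Arrangement K ℓ where
  hyperplanes := A.hyperplanes \ {H}
  finite := A.finite.subset Set.sdiff_subset
  isHyperplane := fun L hL => A.isHyperplane L hL.1

/-- The logarithmic derivation module `D(A) = {θ ∈ Der S | θ(α_H) ∈ S α_H for all H ∈ A}`.
The condition is imposed for every linear form `α` defining `H`; these differ by units only. -/
def logDer (A : Arrangement K ℓ) : Submodule (CoordRing K ℓ) (Der K ℓ) where
  carrier := {θ | ∀ H ∈ A.hyperplanes, ∀ α : Module.Dual K (Fin ℓ → K), LinearMap.ker α = H →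
    θ (linearPoly α) ∈ Ideal.span {linearPoly α}}
  add_mem' := fun ha hb H hH α hα => by
    rw [Derivation.add_apply]
    exact Ideal.add_mem _ (ha H hH α hα) (hb H hH α hα)
  zero_mem' := fun H hH α hα => by
    rw [Derivation.zero_apply]
    exact Ideal.zero_mem _
  smul_mem' := fun c θ hθ H hH α hα => by
    rw [Derivation.smul_apply, smul_eq_mul]
    exact Ideal.mul_mem_left _ c (hθ H hH α hα)

/-- `A` is free: `D(A) ≃ ⊕_{i=1}^ℓ S[-d_i]` as graded modules, that is, `D(A)` has a basis of
`ℓ` homogeneous derivations. -/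
def IsFree (A : Arrangement K ℓ) : Prop :=
  ∃ (d : Fin ℓ → ℕ) (b : Module.Basis (Fin ℓ) (CoordRing K ℓ) A.logDer),
    ∀ i, IsHomogeneousDer (b i : Der K ℓ) (d i)

/-- `G` is a minimal set of generators of the graded module `D(A)`: it consists of homogeneous
elements, it generates `D(A)`, and no proper subset of it does. -/
def IsMinimalGenerators (A : Arrangement K ℓ) (G : Set (Der K ℓ)) : Prop :=
  (∀ θ ∈ G, ∃ d, IsHomogeneousDer θ d) ∧
  Submodule.span (CoordRing K ℓ) G = A.logDer ∧
  ∀ G' : Set (Der K ℓ), G' ⊂ G → Submodule.span (CoordRing K ℓ) G' ≠ A.logDer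

/-- `g(A) = n`: the module `D(A)` has a minimal set of generators with exactly `n` elements
(the cardinality does not depend on the chosen minimal set of homogeneous generators). -/
def HasGenNumber (A : Arrangement K ℓ) (n : ℕ) : Prop :=
  ∃ G : Set (Der K ℓ), A.IsMinimalGenerators G ∧ G.encard = n

/-- `A` is SPOG (strictly plus-one generated) with exponents `d = (1, d_2, …, d_ℓ)` and
level `e`: there is a minimal graded free resolution
`0 → S[-e-1] → (⊕_{i=1}^ℓ S[-d_i]) ⊕ S[-e] → D(A) → 0`
in which the generator of degree `d_1 = 1` goes to the Euler derivation. The maps are `ι` and `π`.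
Strictness: the relation `ι 1` has a non-zero linear form as its coefficient at the level element
`π (0, 1)`. -/
def IsSPOGWith (A : Arrangement K ℓ) (d : Fin ℓ → ℕ) (e : ℕ) : Prop :=
  ∃ (ι : CoordRing K ℓ →ₗ[CoordRing K ℓ] (Fin ℓ → CoordRing K ℓ) × CoordRing K ℓ)
    (π : (Fin ℓ → CoordRing K ℓ) × CoordRing K ℓ →ₗ[CoordRing K ℓ] A.logDer),
    -- the sequence is exact
    Function.Injective ι ∧ Function.Exact ι π ∧ Function.Surjective π ∧
    -- `π` preserves degrees
    (∀ i, IsHomogeneousDer (π (Pi.single i 1, 0) : Der K ℓ) (d i)) ∧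
    IsHomogeneousDer (π (0, 1) : Der K ℓ) e ∧
    -- `ι` preserves degrees
    (∀ i, InShiftedDegree (d i) (e + 1) ((ι 1).1 i)) ∧
    InShiftedDegree e (e + 1) (ι 1).2 ∧
    -- minimality: the entries of the matrix of `ι` lie in the ideal `(x_1, …, x_ℓ)`
    (∀ i, constantCoeff ((ι 1).1 i) = 0) ∧ constantCoeff (ι 1).2 = 0 ∧
    -- strictness
    (ι 1).2 ≠ 0 ∧
    -- the first generator is the Euler derivation
    ∃ h : 0 < ℓ, d ⟨0, h⟩ = 1 ∧ (π (Pi.single ⟨0, h⟩ 1, 0) : Der K ℓ) = eulerDer K ℓ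

/-- `A` is SPOG, for some exponents and some level. -/
def IsSPOG (A : Arrangement K ℓ) : Prop :=
  ∃ (d : Fin ℓ → ℕ) (e : ℕ), A.IsSPOGWith d e

end Arrangement

end HypArr

end

/-! Let `H = ker α`, let `b` be a homogeneous basis of `D(A')`, and put `f i = b i (α)`. A
derivation in `D(A')` with coordinates `c` lies in `D(A)` exactly when `α` divides `∑ c i * f i`, so
`D(A)` becomes a submodule `N` of a free module of rank `ℓ`.

Choose `b` with as few `f i` outside `Sα` as possible. By basis exchange
(`IsOptimalBasis.constantCoeff_eq_zero`), every element of `N` then has no constant term at these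
indices. Hence the `ℓ` obvious elements of `N` (the unit vector `e_i` if `α ∣ f i`, otherwise `α
e_i`) are independent modulo `𝔪N`, where `𝔪 = (x_1, …, x_ℓ)`. As `N` has `ℓ + 1` minimal generators,
graded Nakayama completes them to generators by a single `ψ` (`exists_generator_extending`), which
may be taken zero wherever `α ∣ f i`.

Since `α` is prime, the only relations between these generators are the multiples of `α ψ = ∑ ψ i (α
e_i)`. This is the resolution, with `α` as the linear form at the level element. Minimality is again
the absence of constant terms in `ψ`.

The Euler derivation can be put in the basis once `A'` is non-empty. This holds because `ψ` forces
two non-logarithmic basis elements, while an optimal basis for empty `A'` has at most one. -/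

noncomputable section

namespace HypArr

variable {K : Type*} [Field K] {ℓ : ℕ}

/-! ### Homogeneous components in shifted gradings -/

/-- The degree-`n` component of a polynomial, seen as an element of `S[-a]`. -/
def shiftedComponent (a n : ℕ) : CoordRing K ℓ →ₗ[K] CoordRing K ℓ :=
  if a ≤ n then homogeneousComponent (n - a) else 0

lemma shiftedComponent_of_le {a n : ℕ} (h : a ≤ n) (p : CoordRing K ℓ) :
    shiftedComponent a n p = homogeneousComponent (n - a) p := by
  simp [shiftedComponent, h]

lemma shiftedComponent_of_lt {a n : ℕ} (h : n < a) (p : CoordRing K ℓ) :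
    shiftedComponent a n p = 0 := by
  simp [shiftedComponent, not_le.mpr h]

lemma inShiftedDegree_shiftedComponent (a n : ℕ) (p : CoordRing K ℓ) :
    InShiftedDegree a n (shiftedComponent a n p) := by
  by_cases h : a ≤ n
  · rw [shiftedComponent_of_le h]
    exact Or.inr ⟨h, homogeneousComponent_isHomogeneous _ _⟩
  · exact Or.inl (shiftedComponent_of_lt (not_le.mp h) p)

lemma InShiftedDegree.shiftedComponent_eq_self {a n : ℕ} {p : CoordRing K ℓ}
    (h : InShiftedDegree a n p) : shiftedComponent a n p = p := by
  rcases h with rfl | ⟨h, hp⟩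
  · simp
  · rw [shiftedComponent_of_le h]
    exact homogeneousComponent_eq_self hp

lemma InShiftedDegree.neg {a n : ℕ} {p : CoordRing K ℓ}
    (hp : InShiftedDegree a n p) : InShiftedDegree a n (-p) := by
  rcases hp with rfl | ⟨h, hp⟩
  · exact Or.inl neg_zero
  · exact Or.inr ⟨h, hp.neg⟩

lemma InShiftedDegree.shift {a n : ℕ} {p : CoordRing K ℓ}
    (hp : InShiftedDegree a n p) (m : ℕ) : InShiftedDegree (a + m) (n + m) p := by
  rcases hp with rfl | ⟨h, hp⟩
  · exact Or.inl rfl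
  · refine Or.inr ⟨by omega, ?_⟩
    rwa [show n + m - (a + m) = n - a by omega]

lemma InShiftedDegree.isHomogeneous_mul {a n : ℕ} {p q : CoordRing K ℓ}
    (hp : InShiftedDegree a n p) (hq : q.IsHomogeneous a) : (p * q).IsHomogeneous n := by
  rcases hp with rfl | ⟨h, hp⟩
  · rw [zero_mul]
    exact isHomogeneous_zero _ _ _
  · have := hp.mul hq
    rwa [Nat.sub_add_cancel h] at this

/-- Multiplication by `q` raises degrees by `a`, so only the part of `p` in degree `n - a`
contributes. For `n < a` nothing does, which is why `shiftedComponent` is zero there instead of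
using truncated subtraction. -/
lemma homogeneousComponent_mul_of_isHomogeneous {a : ℕ} {q : CoordRing K ℓ}
    (hq : q.IsHomogeneous a) (n : ℕ) (p : CoordRing K ℓ) :
    homogeneousComponent n (p * q) = shiftedComponent a n p * q := by
  have key : ∀ k, homogeneousComponent n (homogeneousComponent k p * q) =
      if k + a = n then homogeneousComponent k p * q else 0 := fun k => by
    rw [homogeneousComponent_of_mem (m := n)
      ((homogeneousComponent_isHomogeneous k p).mul hq)]
    simp [eq_comm]
  conv_lhs => rw [← sum_homogeneousComponent p, Finset.sum_mul, map_sum]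
  simp_rw [key]
  by_cases h : a ≤ n
  · rw [shiftedComponent_of_le h]
    by_cases h' : p.totalDegree < n - a
    · rw [homogeneousComponent_eq_zero _ _ h', zero_mul]
      refine Finset.sum_eq_zero fun k hk => if_neg ?_
      have := Finset.mem_range.mp hk
      omega
    · rw [Finset.sum_eq_single (n - a)]
      · rw [if_pos (by omega)]
      · intro k _ hk
        exact if_neg (by omega)
      · intro hk
        exact absurd (Finset.mem_range.mpr (by omega)) hk
  · rw [shiftedComponent_of_lt (not_le.mp h), zero_mul]
    exact Finset.sum_eq_zero fun k _ => if_neg (by omega)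

lemma shiftedComponent_mul_of_inShiftedDegree {a n k : ℕ} {q : CoordRing K ℓ}
    (hq : InShiftedDegree a k q) (p : CoordRing K ℓ) :
    shiftedComponent a n (p * q) = shiftedComponent k n p * q := by
  rcases hq with rfl | ⟨h, hq⟩
  · simp
  by_cases h' : a ≤ n
  · rw [shiftedComponent_of_le h', homogeneousComponent_mul_of_isHomogeneous hq]
    by_cases h'' : k ≤ n
    · rw [shiftedComponent_of_le h'', shiftedComponent_of_le (by omega)]
      congr 3
      omega
    · rw [shiftedComponent_of_lt (by omega), shiftedComponent_of_lt (by omega)]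
  · rw [shiftedComponent_of_lt (by omega), shiftedComponent_of_lt (by omega), zero_mul]

lemma shiftedComponent_self (a : ℕ) (p : CoordRing K ℓ) :
    shiftedComponent a a p = C (constantCoeff p) := by
  rw [shiftedComponent_of_le le_rfl, Nat.sub_self, homogeneousComponent_zero, constantCoeff_eq]

/-! ### Graded Nakayama in a graded free module -/

section GradedFree

variable {ι κ μ : Type*}

/-- The degree-`e` component of an element of the graded free module `⊕ S[-d_i]`. -/
def gradedComponent (d : ι → ℕ) (e : ℕ) : (ι → CoordRing K ℓ) →ₗ[K] (ι → CoordRing K ℓ) :=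
  LinearMap.pi fun i => (shiftedComponent (d i) e).comp (LinearMap.proj i)

lemma gradedComponent_apply (d : ι → ℕ) (e : ℕ) (c : ι → CoordRing K ℓ) (i : ι) :
    gradedComponent d e c i = shiftedComponent (d i) e (c i) := rfl

/-- `c` is homogeneous of degree `e` in the graded free module `⊕ S[-d_i]`. -/
def IsHomogeneousVec (d : ι → ℕ) (e : ℕ) (c : ι → CoordRing K ℓ) : Prop :=
  ∀ i, InShiftedDegree (d i) e (c i)

lemma gradedComponent_smul {d : ι → ℕ} {e k : ℕ} {c : ι → CoordRing K ℓ}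
    (hc : IsHomogeneousVec d k c) (p : CoordRing K ℓ) :
    gradedComponent d e (p • c) = shiftedComponent k e p • c := by
  ext1 i
  simp only [gradedComponent_apply, Pi.smul_apply, smul_eq_mul]
  exact shiftedComponent_mul_of_inShiftedDegree (hc i) p

lemma gradedComponent_sum_smul [Fintype κ] {d : ι → ℕ} {g : κ → ι → CoordRing K ℓ} {k : κ → ℕ}
    (hg : ∀ j, IsHomogeneousVec d (k j) (g j)) (e : ℕ) (p : κ → CoordRing K ℓ) :
    gradedComponent d e (∑ j, p j • g j) = ∑ j, shiftedComponent (k j) e (p j) • g j := by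
  rw [map_sum]
  exact Finset.sum_congr rfl fun j _ => gradedComponent_smul (hg j) _

lemma IsHomogeneousVec.gradedComponent_eq_self {d : ι → ℕ} {e : ℕ} {c : ι → CoordRing K ℓ}
    (hc : IsHomogeneousVec d e c) : gradedComponent d e c = c := by
  ext1 i
  exact (hc i).shiftedComponent_eq_self

/-- The relations between irredundant homogeneous generators have no constant terms. -/
lemma constantCoeff_eq_zero_of_relation [Fintype κ] {d : ι → ℕ} {g : κ → ι → CoordRing K ℓ}
    {k : κ → ℕ} (hg : ∀ j, IsHomogeneousVec d (k j) (g j))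
    (hirr : ∀ j, g j ∉ Submodule.span (CoordRing K ℓ) (g '' {j}ᶜ))
    {p : κ → CoordRing K ℓ} (hp : ∑ j, p j • g j = 0) (j : κ) : constantCoeff (p j) = 0 := by
  classical
  by_contra hj
  -- In degree `k j` the coefficient of `g j` becomes a non-zero constant, so `g j` can be solved
  -- for.
  have h0 := gradedComponent_sum_smul hg (k j) p
  rw [hp, map_zero, ← Finset.add_sum_erase _ _ (Finset.mem_univ j), shiftedComponent_self] at h0
  refine hirr j ?_
  have hmem : (C (constantCoeff (p j)) : CoordRing K ℓ) • g j ∈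
      Submodule.span (CoordRing K ℓ) (g '' {j}ᶜ) := by
    rw [eq_neg_of_add_eq_zero_left h0.symm]
    refine neg_mem (Submodule.sum_mem _ fun i hi => Submodule.smul_mem _ _ ?_)
    exact Submodule.subset_span ⟨i, by simpa using (Finset.mem_erase.mp hi).1, rfl⟩
  have := Submodule.smul_mem _ (C (constantCoeff (p j))⁻¹) hmem
  rwa [smul_smul, ← C_mul, inv_mul_cancel₀ hj, C_1, one_smul] at this

/-- Graded Nakayama: homogeneous elements that generate a module, generated by homogeneous
elements `g j`, up to combinations of the `g j` without constant terms, generate it. -/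
lemma mem_span_of_sub_mem [Fintype κ] [Fintype μ] {d : ι → ℕ} {g : κ → ι → CoordRing K ℓ}
    {k : κ → ℕ} (hg : ∀ j, IsHomogeneousVec d (k j) (g j)) {y : μ → ι → CoordRing K ℓ} {k' : μ → ℕ}
    (hy : ∀ j, IsHomogeneousVec d (k' j) (y j))
    (h : ∀ j, ∃ m : κ → CoordRing K ℓ, ∃ q : μ → CoordRing K ℓ, (∀ i, constantCoeff (m i) = 0) ∧
      g j = ∑ i, q i • y i + ∑ i, m i • g i) (j : κ) :
    g j ∈ Submodule.span (CoordRing K ℓ) (Set.range y) := by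
  induction hn : k j using Nat.strong_induction_on generalizing j with
  | _ n ih =>
    subst hn
    obtain ⟨m, q, hm, hj⟩ := h j
    have := congrArg (gradedComponent d (k j)) hj
    rw [(hg j).gradedComponent_eq_self, map_add, gradedComponent_sum_smul hy,
      gradedComponent_sum_smul hg] at this
    rw [this]
    refine add_mem (Submodule.sum_mem _ fun i _ => Submodule.smul_mem _ _ ?_)
      (Submodule.sum_mem _ fun i _ => ?_)
    · exact Submodule.subset_span ⟨i, rfl⟩
    -- In degree `k j`, generators of higher degree disappear and those of equal degree carry the
    -- constant term of `m i`, which is zero. Only lower degrees remain, covered by induction.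
    · rcases lt_trichotomy (k i) (k j) with hlt | heq | hgt
      · exact Submodule.smul_mem _ _ (ih (k i) hlt i rfl)
      · rw [heq, shiftedComponent_self, hm, C_0, zero_smul]
        exact zero_mem _
      · rw [shiftedComponent_of_lt hgt, zero_smul]
        exact zero_mem _

end GradedFree

/-! ### Completing a partial set of minimal generators -/

section Exchange

variable {ι κ : Type*} [Fintype ι] [Fintype κ]

/-- Homogeneous elements `x i` that are linearly independent modulo `𝔪 N`, one fewer than the
minimal generators `g j` of `N`, generate `N` together with one of the `g j`. -/
lemma exists_generator_extending {d : ι → ℕ} {g : κ → ι → CoordRing K ℓ} {k : κ → ℕ}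
    (hcard : Fintype.card κ = Fintype.card ι + 1)
    (hg : ∀ j, IsHomogeneousVec d (k j) (g j))
    (hirr : ∀ j, g j ∉ Submodule.span (CoordRing K ℓ) (g '' {j}ᶜ))
    {x : ι → ι → CoordRing K ℓ} {k' : ι → ℕ} (hx : ∀ i, IsHomogeneousVec d (k' i) (x i))
    (hxg : ∀ i, x i ∈ Submodule.span (CoordRing K ℓ) (Set.range g))
    (hind : ∀ (a : ι → K) (m : κ → CoordRing K ℓ), (∀ j, constantCoeff (m j) = 0) →
      ∑ i, (C (a i) : CoordRing K ℓ) • x i = ∑ j, m j • g j → ∀ i, a i = 0) :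
    ∃ j₀, g j₀ ∉ Submodule.span (CoordRing K ℓ) (Set.range x) ∧
      ∀ j, g j ∈ Submodule.span (CoordRing K ℓ)
        (Set.range fun o : Option ι => o.elim (g j₀) x) := by
  classical
  have hP : ∀ i, ∃ p : κ → CoordRing K ℓ, ∑ j, p j • g j = x i := fun i =>
    (Submodule.mem_span_range_iff_exists_fun _).mp (hxg i)
  choose P hP using hP
  -- By irredundancy the classes of the `g j` form a basis of `N/𝔪N`; `v i` is the class of `x i` in
  -- this basis.
  let v : ι → κ → K := fun i j => constantCoeff (P i j)
  have hv : LinearIndependent K v := by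
    rw [Fintype.linearIndependent_iff]
    intro a ha
    refine hind a (fun j => ∑ i, C (a i) * P i j) (fun j => ?_) ?_
    · have := congrFun ha j
      simpa [v] using this
    · simp_rw [← hP, Finset.smul_sum, Finset.sum_smul, smul_smul]
      exact Finset.sum_comm
  have hj₀ : ∃ j₀, (Pi.single j₀ 1 : κ → K) ∉ Submodule.span K (Set.range v) := by
    by_contra! hcon
    have htop : Submodule.span K (Set.range v) = ⊤ := by
      rw [eq_top_iff, ← (Pi.basisFun K κ).span_eq, Submodule.span_le]
      rintro _ ⟨j, rfl⟩
      simpa using hcon j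
    have h1 := finrank_range_le_card (R := K) v
    rw [Set.finrank, htop, finrank_top, Module.finrank_fintype_fun_eq_card] at h1
    omega
  obtain ⟨j₀, hj₀⟩ := hj₀
  refine ⟨j₀, fun hmem => hj₀ ?_, ?_⟩
  · obtain ⟨q, hq⟩ := (Submodule.mem_span_range_iff_exists_fun _).mp hmem
    -- Expanding each `x i` in the `g j` turns the membership into a relation between minimal
    -- generators. Its constant terms vanish, which puts the unit vector at `j₀` into the span of
    -- `v`.
    have hrel : ∑ j, ((Pi.single j₀ 1 : κ → CoordRing K ℓ) j - ∑ i, q i * P i j) • g j = 0 := by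
      simp_rw [sub_smul, Finset.sum_sub_distrib, Finset.sum_smul, mul_smul]
      rw [Finset.sum_comm]
      simp_rw [← Finset.smul_sum, hP, hq]
      simp [Pi.single_apply]
    have h0 := constantCoeff_eq_zero_of_relation hg hirr hrel
    rw [Submodule.mem_span_range_iff_exists_fun]
    refine ⟨fun i => constantCoeff (q i), ?_⟩
    ext1 j
    have := h0 j
    rw [map_sub, sub_eq_zero, map_sum] at this
    simp only [Finset.sum_apply, Pi.smul_apply, smul_eq_mul, v, ← map_mul]
    rw [← this]
    by_cases h : j = j₀
    · subst h
      simp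
    · simp [h]
  · let w : Option ι → κ → K := fun o => o.elim (Pi.single j₀ 1) v
    have hw : LinearIndependent K w := linearIndependent_option.mpr ⟨hv, hj₀⟩
    have hspan : Submodule.span K (Set.range w) = ⊤ :=
      hw.span_eq_top_of_card_eq_finrank' (by simp [hcard])
    let Q : Option ι → κ → CoordRing K ℓ := fun o => o.elim (Pi.single j₀ 1) P
    let y : Option ι → ι → CoordRing K ℓ := fun o => o.elim (g j₀) x
    have hQ : ∀ o, ∑ j, Q o j • g j = y o := by
      rintro (_ | i)
      · simp [Q, y, Pi.single_apply]
      · exact hP i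
    have hQw : ∀ o j, constantCoeff (Q o j) = w o j := by
      rintro (_ | i) j
      · by_cases h : j = j₀
        · subst h
          simp [Q, w]
        · simp [Q, w, h]
      · rfl
    have hy : ∀ o : Option ι, IsHomogeneousVec d (o.elim (k j₀) k') (y o) := by
      rintro (_ | i)
      · exact hg j₀
      · exact hx i
    refine mem_span_of_sub_mem hg hy fun j => ?_
    have hj : (Pi.single j 1 : κ → K) ∈ Submodule.span K (Set.range w) := hspan ▸ trivial
    obtain ⟨a, ha⟩ := (Submodule.mem_span_range_iff_exists_fun _).mp hj
    -- Lift the expansion of the `j`-th unit vector in the basis `w` to constant coefficients. The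
    -- error, written in the `g i`, then has no constant terms.
    refine ⟨fun i => (Pi.single j 1 : κ → CoordRing K ℓ) i - ∑ o, C (a o) * Q o i,
      fun o => C (a o), fun i => ?_, ?_⟩
    · have := congrFun ha i
      simp only [Finset.sum_apply, Pi.smul_apply, smul_eq_mul] at this
      simp only [map_sub, map_sum, map_mul, constantCoeff_C, hQw, this]
      by_cases h : i = j
      · subst h
        simp
      · simp [h]
    · simp_rw [sub_smul, Finset.sum_sub_distrib, Finset.sum_smul, mul_smul]
      rw [Finset.sum_comm (s := Finset.univ (α := κ))]
      simp_rw [← Finset.smul_sum, hQ]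
      simp only [Pi.single_apply, ite_smul, one_smul, zero_smul, Finset.sum_ite_eq',
        Finset.mem_univ, if_true]
      exact (add_sub_cancel _ _).symm

end Exchange

/-! ### Linear forms as prime elements -/

section LinearForm

lemma isHomogeneous_linearPoly (α : Module.Dual K (Fin ℓ → K)) :
    (linearPoly α).IsHomogeneous 1 :=
  IsHomogeneous.sum _ _ _ fun i _ => isHomogeneous_C_mul_X _ i

lemma pderiv_linearPoly (α : Module.Dual K (Fin ℓ → K)) (i : Fin ℓ) :
    pderiv i (linearPoly α) = C (α (Pi.single i 1)) := by
  simp [linearPoly, pderiv_X, Pi.single_apply]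

lemma exists_apply_single_ne_zero {α : Module.Dual K (Fin ℓ → K)} (hα : α ≠ 0) :
    ∃ i, α (Pi.single i 1) ≠ 0 := by
  by_contra! h
  exact hα ((Pi.basisFun K (Fin ℓ)).ext fun i => by simpa using h i)

lemma linearPoly_ne_zero {α : Module.Dual K (Fin ℓ → K)} (hα : α ≠ 0) : linearPoly α ≠ 0 := by
  obtain ⟨i, hi⟩ := exists_apply_single_ne_zero hα
  intro h
  have := pderiv_linearPoly α i
  rw [h, map_zero, eq_comm, C_eq_zero] at this
  exact hi this

lemma prime_linearPoly {α : Module.Dual K (Fin ℓ → K)} (hα : α ≠ 0) : Prime (linearPoly α) := by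
  refine (irreducible_of_totalDegree_eq_one
    ((isHomogeneous_linearPoly α).totalDegree (linearPoly_ne_zero hα)) fun x hx => ?_).prime
  obtain ⟨s, hs⟩ := exists_coeff_ne_zero (linearPoly_ne_zero hα)
  refine IsUnit.mk0 x ?_
  rintro rfl
  exact hs (zero_dvd_iff.mp (hx s))

lemma constantCoeff_linearPoly (α : Module.Dual K (Fin ℓ → K)) :
    constantCoeff (linearPoly α) = 0 := by
  simp [linearPoly]

lemma dvd_homogeneousComponent {α : Module.Dual K (Fin ℓ → K)} {p : CoordRing K ℓ}
    (h : linearPoly α ∣ p) (n : ℕ) : linearPoly α ∣ homogeneousComponent n p := by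
  obtain ⟨q, rfl⟩ := h
  rw [mul_comm, homogeneousComponent_mul_of_isHomogeneous (isHomogeneous_linearPoly α)]
  exact dvd_mul_left _ _

lemma linearPoly_smul (c : K) (α : Module.Dual K (Fin ℓ → K)) :
    linearPoly (c • α) = C c * linearPoly α := by
  simp [linearPoly, Finset.mul_sum, mul_assoc]

end LinearForm

/-! ### Relations modulo a linear form -/

section Relations

variable {ι κ : Type*}

/-- The vectors `c` for which `∑ c_i f_i` is divisible by the linear form `α`. -/
def relationModule [Fintype ι] (α : Module.Dual K (Fin ℓ → K)) (f : ι → CoordRing K ℓ) :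
    Submodule (CoordRing K ℓ) (ι → CoordRing K ℓ) :=
  Submodule.comap (Fintype.linearCombination (CoordRing K ℓ) f) (Ideal.span {linearPoly α})

lemma mem_relationModule [Fintype ι] {α : Module.Dual K (Fin ℓ → K)} {f : ι → CoordRing K ℓ}
    {c : ι → CoordRing K ℓ} : c ∈ relationModule α f ↔ linearPoly α ∣ ∑ i, c i * f i := by
  rw [relationModule, Submodule.mem_comap, Ideal.mem_span_singleton,
    Fintype.linearCombination_apply]
  rfl

open Classical in
/-- The obvious elements of the relation module: multiples of the unit vectors. -/
def trivialRelation (α : Module.Dual K (Fin ℓ → K)) (f : ι → CoordRing K ℓ) (i : ι) :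
    ι → CoordRing K ℓ :=
  Pi.single i (if linearPoly α ∣ f i then 1 else linearPoly α)

variable {α : Module.Dual K (Fin ℓ → K)} {f : ι → CoordRing K ℓ}

lemma trivialRelation_mem [Fintype ι] (i : ι) : trivialRelation α f i ∈ relationModule α f := by
  classical
  rw [mem_relationModule, Finset.sum_eq_single i]
  · by_cases h : linearPoly α ∣ f i <;> simp [trivialRelation, h]
  · intro j _ hj
    simp [trivialRelation, hj]
  · simp

lemma sum_smul_trivialRelation [Fintype ι] (q : ι → CoordRing K ℓ) (i : ι) :
    (∑ j, q j • trivialRelation α f j) i = q i * trivialRelation α f i i := by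
  classical
  rw [Finset.sum_apply, Finset.sum_eq_single i]
  · simp
  · intro j _ hj
    simp [trivialRelation, hj.symm]
  · simp

lemma trivialRelation_self_of_dvd {i : ι} (h : linearPoly α ∣ f i) :
    trivialRelation α f i i = 1 := by
  simp [trivialRelation, h]

lemma trivialRelation_self_of_not_dvd {i : ι} (h : ¬ linearPoly α ∣ f i) :
    trivialRelation α f i i = linearPoly α := by
  simp [trivialRelation, h]

lemma mem_span_trivialRelation [Fintype ι] {c : ι → CoordRing K ℓ}
    (h : ∀ t, ¬ linearPoly α ∣ f t → linearPoly α ∣ c t) :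
    c ∈ Submodule.span (CoordRing K ℓ) (Set.range (trivialRelation α f)) := by
  have : ∀ i, ∃ q, q * trivialRelation α f i i = c i := fun i => by
    by_cases hi : linearPoly α ∣ f i
    · exact ⟨c i, by rw [trivialRelation_self_of_dvd hi, mul_one]⟩
    · obtain ⟨q, hq⟩ := h i hi
      exact ⟨q, by rw [trivialRelation_self_of_not_dvd hi, hq, mul_comm]⟩
  choose q hq using this
  rw [Submodule.mem_span_range_iff_exists_fun]
  exact ⟨q, funext fun i => by rw [sum_smul_trivialRelation, hq]⟩

open Classical in
lemma isHomogeneousVec_trivialRelation (d : ι → ℕ) (i : ι) :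
    IsHomogeneousVec d (if linearPoly α ∣ f i then d i else d i + 1) (trivialRelation α f i) := by
  intro j
  by_cases hj : j = i
  · subst hj
    by_cases h : linearPoly α ∣ f j
    · rw [trivialRelation_self_of_dvd h, if_pos h]
      refine Or.inr ⟨le_rfl, ?_⟩
      rw [Nat.sub_self]
      exact isHomogeneous_one _ _
    · rw [trivialRelation_self_of_not_dvd h, if_neg h]
      refine Or.inr ⟨by omega, ?_⟩
      rw [Nat.add_sub_cancel_left]
      exact isHomogeneous_linearPoly α
  · exact Or.inl (by simp [trivialRelation, hj])

lemma koszulRelation_mem [Fintype ι] [DecidableEq ι] (s t : ι) :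
    Pi.single s (f t) - Pi.single t (f s) ∈ relationModule α f := by
  rw [mem_relationModule]
  simp [sub_mul, Finset.sum_sub_distrib, Pi.single_apply, mul_comm (f t)]

/-- If all relations have no constant terms outside the multiples of `α`, and the relation module
has exactly one more minimal generator than its rank, then exactly two of the `f i` are not
multiples of `α`, and modulo `α` their relations are generated by a single one. -/
theorem exists_relation_generator [Fintype ι] [Fintype κ] (hα : α ≠ 0)
    (hmin : ∀ c ∈ relationModule α f, ∀ t, ¬ linearPoly α ∣ f t → constantCoeff (c t) = 0)
    {d : ι → ℕ} {g : κ → ι → CoordRing K ℓ} {k : κ → ℕ}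
    (hcard : Fintype.card κ = Fintype.card ι + 1)
    (hg : ∀ j, IsHomogeneousVec d (k j) (g j))
    (hirr : ∀ j, g j ∉ Submodule.span (CoordRing K ℓ) (g '' {j}ᶜ))
    (hspan : Submodule.span (CoordRing K ℓ) (Set.range g) = relationModule α f) :
    ∃ (t₁ t₂ : ι) (e : ℕ) (ψ : ι → CoordRing K ℓ), t₁ ≠ t₂ ∧
      ¬ linearPoly α ∣ f t₁ ∧ ¬ linearPoly α ∣ f t₂ ∧
      (∀ t, ¬ linearPoly α ∣ f t → t = t₁ ∨ t = t₂) ∧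
      IsHomogeneousVec d e ψ ∧ ψ ∈ relationModule α f ∧
      (∀ t, linearPoly α ∣ f t → ψ t = 0) ∧ ¬ linearPoly α ∣ ψ t₁ ∧
      ∀ c ∈ relationModule α f, ∃ p, ∀ t, ¬ linearPoly α ∣ f t → linearPoly α ∣ c t - p * ψ t := by
  classical
  have hprime := prime_linearPoly hα
  obtain ⟨v, hv⟩ := exists_apply_single_ne_zero hα
  have hgN : ∀ j, g j ∈ relationModule α f := fun j =>
    hspan ▸ Submodule.subset_span ⟨j, rfl⟩
  obtain ⟨j₀, hj₀, hgen⟩ := exists_generator_extending hcard hg hirr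
    (isHomogeneousVec_trivialRelation (α := α) (f := f) d)
    (fun i => hspan ▸ trivialRelation_mem i) (fun a m hm h i => by
      have hi := congrFun h i
      have hsum := sum_smul_trivialRelation (α := α) (f := f) (fun i => C (a i)) i
      rw [hsum] at hi
      simp only [Finset.sum_apply, Pi.smul_apply, smul_eq_mul] at hi
      by_cases hfi : linearPoly α ∣ f i
      · rw [trivialRelation_self_of_dvd hfi, mul_one] at hi
        have := congrArg constantCoeff hi
        simpa [hm] using this
      · rw [trivialRelation_self_of_not_dvd hfi] at hi
        -- Both factors of each `m j * g j i` lack a constant term, so its derivative does too. The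
        -- left side yields `a i` times the non-zero `α (Pi.single v 1)`.
        have := congrArg (fun p => constantCoeff (pderiv v p)) hi
        simpa [hm, pderiv_linearPoly, hmin _ (hgN _) i hfi, Derivation.leibniz, hv] using this)
  -- Entries where `α ∣ f t` do not affect membership and are absorbed by unit vectors, so they may
  -- be erased.
  let ψ : ι → CoordRing K ℓ := fun t => if linearPoly α ∣ f t then 0 else g j₀ t
  have hψg : ∀ t, ¬ linearPoly α ∣ f t → ψ t = g j₀ t := fun t ht => if_neg ht
  have hψ0 : ∀ t, linearPoly α ∣ f t → ψ t = 0 := fun t ht => if_pos ht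
  have hψN : ψ ∈ relationModule α f := by
    have h1 : g j₀ - ψ ∈ relationModule α f := by
      rw [mem_relationModule]
      refine Finset.dvd_sum fun i _ => ?_
      by_cases hi : linearPoly α ∣ f i
      · exact hi.mul_left _
      · rw [Pi.sub_apply, hψg i hi, sub_self, zero_mul]
        exact dvd_zero _
    simpa using sub_mem (hgN j₀) h1
  have hψhom : IsHomogeneousVec d (k j₀) ψ := fun t => by
    by_cases ht : linearPoly α ∣ f t
    · exact Or.inl (hψ0 t ht)
    · rw [hψg t ht]
      exact hg j₀ t
  have hmod : ∀ c ∈ relationModule α f,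
      ∃ p, ∀ t, ¬ linearPoly α ∣ f t → linearPoly α ∣ c t - p * ψ t := by
    intro c hc
    have hc' : c ∈ Submodule.span (CoordRing K ℓ)
        (Set.range fun o : Option ι => o.elim (g j₀) (trivialRelation α f)) := by
      rw [← hspan] at hc
      refine (Submodule.span_le.mpr ?_) hc
      rintro _ ⟨j, rfl⟩
      exact hgen j
    obtain ⟨q, hq⟩ := (Submodule.mem_span_range_iff_exists_fun _).mp hc'
    refine ⟨q none, fun t ht => ?_⟩
    rw [Fintype.sum_option] at hq
    have h1 := congrFun hq t
    have h2 := sum_smul_trivialRelation (α := α) (f := f) (fun i => q (some i)) t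
    simp only [Option.elim_none, Option.elim_some, Pi.add_apply, Pi.smul_apply,
      smul_eq_mul] at h1 h2
    rw [h2, trivialRelation_self_of_not_dvd ht] at h1
    rw [← h1, hψg t ht, add_sub_cancel_left]
    exact dvd_mul_left _ _
  obtain ⟨t₁, ht₁, hψ₁⟩ : ∃ t, ¬ linearPoly α ∣ f t ∧ ¬ linearPoly α ∣ ψ t := by
    by_contra! hcon
    exact hj₀ (mem_span_trivialRelation fun t ht => hψg t ht ▸ hcon t ht)
  obtain ⟨t₂, ht₂, hne⟩ : ∃ t, ¬ linearPoly α ∣ f t ∧ t₁ ≠ t := by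
    by_contra! hcon
    have h1 := mem_relationModule.mp hψN
    rw [← Finset.add_sum_erase _ _ (Finset.mem_univ t₁)] at h1
    -- With `t₁` as the only index where `α ∤ f t`, membership of `ψ` would give `α ∣ ψ t₁ * f t₁`.
    refine (hprime.dvd_or_dvd ((dvd_add_left (Finset.dvd_sum fun i hi => ?_)).mp h1)).elim hψ₁ ht₁
    by_cases hfi : linearPoly α ∣ f i
    · exact hfi.mul_left _
    · exact absurd (hcon i hfi).symm (Finset.mem_erase.mp hi).1
  refine ⟨t₁, t₂, k j₀, ψ, hne, ht₁, ht₂, fun t₃ ht₃ => ?_, hψhom, hψN, hψ0, hψ₁, hmod⟩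
  by_contra! hcon
  -- Modulo `α`, the Koszul relation on `t₁, t₂` is `p * ψ` with `p` non-zero and vanishes at `t₃`,
  -- so `ψ t₃` vanishes. The one on `t₁, t₃` is also a multiple of `ψ`, yet its entry at `t₃` is `-f
  -- t₁`.
  obtain ⟨p, hp⟩ := hmod _ (koszulRelation_mem t₁ t₂)
  obtain ⟨q, hq⟩ := hmod _ (koszulRelation_mem t₁ t₃)
  have h1 := hp t₁ ht₁
  have h3 := hp t₃ ht₃
  have h4 := hq t₃ ht₃
  simp only [Pi.sub_apply, Pi.single_eq_same, Pi.single_eq_of_ne hne, sub_zero,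
    Pi.single_eq_of_ne hcon.1, Pi.single_eq_of_ne hcon.2, zero_sub, dvd_neg] at h1 h3 h4
  have hψ₃ : linearPoly α ∣ ψ t₃ := (hprime.dvd_or_dvd h3).resolve_left fun hpα =>
    ht₂ ((dvd_sub_left (hpα.mul_right _)).mp h1)
  exact ht₁ ((dvd_neg).mp ((dvd_sub_left (hψ₃.mul_left _)).mp h4))

end Relations

/-! ### Derivations applied to linear forms, and deletion -/

section Derivations

lemma der_linearPoly (θ : Der K ℓ) (α : Module.Dual K (Fin ℓ → K)) :
    θ (linearPoly α) = ∑ i, C (α (Pi.single i 1)) * θ (X i) := by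
  simp [linearPoly]

lemma IsHomogeneousDer.apply_linearPoly {θ : Der K ℓ} {d : ℕ} (hθ : IsHomogeneousDer θ d)
    (α : Module.Dual K (Fin ℓ → K)) : (θ (linearPoly α)).IsHomogeneous d := by
  rw [der_linearPoly]
  exact IsHomogeneous.sum _ _ _ fun i _ => (hθ i).C_mul _

lemma eulerDer_linearPoly (α : Module.Dual K (Fin ℓ → K)) :
    eulerDer K ℓ (linearPoly α) = linearPoly α := by
  rw [der_linearPoly, linearPoly]
  simp [eulerDer, mkDerivation_X]

lemma isHomogeneousDer_eulerDer : IsHomogeneousDer (eulerDer K ℓ) 1 := fun i => by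
  rw [eulerDer, mkDerivation_X]
  exact isHomogeneous_X K i

lemma exists_smul_eq_of_ker_eq {α β : Module.Dual K (Fin ℓ → K)}
    (h : LinearMap.ker α = LinearMap.ker β) : ∃ c : Kˣ, c • α = β := by
  by_cases hα : α = 0
  · refine ⟨1, ?_⟩
    rw [hα, LinearMap.ker_zero, eq_comm, LinearMap.ker_eq_top] at h
    rw [hα, h, smul_zero]
  · have hmem : β ∈ Submodule.span K (Set.range fun _ : Unit => α) :=
      FiniteDimensional.mem_span_of_iInf_ker_le_ker (by simp [h])
    rw [Set.range_const, Submodule.mem_span_singleton] at hmem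
    obtain ⟨c, rfl⟩ := hmem
    have hc : c ≠ 0 := by
      rintro rfl
      rw [zero_smul, LinearMap.ker_zero, LinearMap.ker_eq_top] at h
      exact hα h
    exact ⟨Units.mk0 c hc, rfl⟩

lemma dvd_apply_linearPoly_of_ker_eq {α β : Module.Dual K (Fin ℓ → K)}
    (h : LinearMap.ker α = LinearMap.ker β) {θ : Der K ℓ}
    (hθ : linearPoly α ∣ θ (linearPoly α)) : linearPoly β ∣ θ (linearPoly β) := by
  obtain ⟨c, rfl⟩ := exists_smul_eq_of_ker_eq h
  rw [Units.smul_def, linearPoly_smul, Derivation.leibniz, derivation_C, smul_zero, add_zero,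
    smul_eq_mul]
  exact mul_dvd_mul_left _ hθ

namespace Arrangement

variable {A : Arrangement K ℓ}

lemma mem_logDer {θ : Der K ℓ} : θ ∈ A.logDer ↔ ∀ α : Module.Dual K (Fin ℓ → K),
    LinearMap.ker α ∈ A.hyperplanes → linearPoly α ∣ θ (linearPoly α) := by
  refine ⟨fun h α hα => Ideal.mem_span_singleton.mp (h _ hα α rfl), fun h L hL α hα => ?_⟩
  subst hα
  exact Ideal.mem_span_singleton.mpr (h α hL)

lemma eulerDer_mem_logDer : eulerDer K ℓ ∈ A.logDer :=
  mem_logDer.mpr fun α _ => by rw [eulerDer_linearPoly]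

lemma mem_logDer_iff_delete {α : Module.Dual K (Fin ℓ → K)}
    (hα : LinearMap.ker α ∈ A.hyperplanes) {θ : Der K ℓ} :
    θ ∈ A.logDer ↔ θ ∈ (A.delete (LinearMap.ker α)).logDer ∧
      linearPoly α ∣ θ (linearPoly α) := by
  simp only [mem_logDer]
  refine ⟨fun h => ⟨fun β hβ => h β hβ.1, h α hα⟩, fun h β hβ => ?_⟩
  by_cases hαβ : LinearMap.ker α = LinearMap.ker β
  · exact dvd_apply_linearPoly_of_ker_eq hαβ h.2
  · exact h.1 β ⟨hβ, fun h' => hαβ h'.symm⟩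

end Arrangement

end Derivations

/-! ### Homogeneous bases and exchange -/

section Bases

variable {ι : Type*} {M : Submodule (CoordRing K ℓ) (Der K ℓ)}

/-- All elements of the basis are homogeneous. -/
def IsHomogeneousBasis (b : Module.Basis ι (CoordRing K ℓ) M) : Prop :=
  ∀ i, ∃ d, IsHomogeneousDer (b i : Der K ℓ) d

lemma IsHomogeneousBasis.of_eq_update [DecidableEq ι] {b b' : Module.Basis ι (CoordRing K ℓ) M}
    (hb : IsHomogeneousBasis b) {v : M} {t : ι} {e : ℕ} (hv : IsHomogeneousDer (v : Der K ℓ) e)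
    (h : ⇑b' = Function.update b t v) : IsHomogeneousBasis b' := fun i => by
  rw [h]
  by_cases hi : i = t
  · subst hi
    exact ⟨e, by rwa [Function.update_self]⟩
  · rw [Function.update_of_ne hi]
    exact hb i

variable [Fintype ι]

/-- The derivation with given coordinates with respect to a basis. -/
def derOfCoord (b : Module.Basis ι (CoordRing K ℓ) M) :
    (ι → CoordRing K ℓ) →ₗ[CoordRing K ℓ] Der K ℓ :=
  M.subtype ∘ₗ b.equivFun.symm.toLinearMap

variable {b : Module.Basis ι (CoordRing K ℓ) M}

lemma derOfCoord_mem (c : ι → CoordRing K ℓ) : derOfCoord b c ∈ M :=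
  (b.equivFun.symm c).2

lemma derOfCoord_injective : Function.Injective (derOfCoord b) :=
  M.injective_subtype.comp b.equivFun.symm.injective

lemma derOfCoord_equivFun (θ : M) : derOfCoord b (b.equivFun θ) = θ := by
  simp [derOfCoord]

lemma derOfCoord_eq_sum (c : ι → CoordRing K ℓ) :
    derOfCoord b c = ∑ i, c i • (b i : Der K ℓ) := by
  simp [derOfCoord, Module.Basis.equivFun_symm_apply]

lemma derOfCoord_apply (c : ι → CoordRing K ℓ) (p : CoordRing K ℓ) :
    derOfCoord b c p = ∑ i, c i * (b i : Der K ℓ) p := by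
  rw [derOfCoord_eq_sum]
  change Derivation.coeFnAddMonoidHom _ p = _
  rw [map_sum, Finset.sum_apply]
  rfl

lemma derOfCoord_single [DecidableEq ι] (i : ι) (p : CoordRing K ℓ) :
    derOfCoord b (Pi.single i p) = p • (b i : Der K ℓ) := by
  rw [derOfCoord_eq_sum, Finset.sum_eq_single i]
  · simp
  · intro j _ hj
    simp [hj]
  · simp

lemma IsHomogeneousVec.isHomogeneousDer {d : ι → ℕ}
    (hb : ∀ i, IsHomogeneousDer (b i : Der K ℓ) (d i))
    {e : ℕ} {c : ι → CoordRing K ℓ} (hc : IsHomogeneousVec d e c) :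
    IsHomogeneousDer (derOfCoord b c) e := fun v => by
  rw [derOfCoord_apply]
  exact IsHomogeneous.sum _ _ _ fun i _ => (hc i).isHomogeneous_mul (hb i v)

/-- Replacing the coordinates by their degree-`e` components does not change the derivation, so by
uniqueness of coordinates it does not change them either. -/
lemma IsHomogeneousDer.isHomogeneousVec {d : ι → ℕ}
    (hb : ∀ i, IsHomogeneousDer (b i : Der K ℓ) (d i))
    {e : ℕ} {c : ι → CoordRing K ℓ} (hc : IsHomogeneousDer (derOfCoord b c) e) :
    IsHomogeneousVec d e c := by
  have h : derOfCoord b (gradedComponent d e c) = derOfCoord b c := by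
    refine derivation_ext fun v => ?_
    rw [← homogeneousComponent_eq_self (hc v), derOfCoord_apply, derOfCoord_apply, map_sum]
    refine Finset.sum_congr rfl fun i _ => ?_
    rw [homogeneousComponent_mul_of_isHomogeneous (hb i v), gradedComponent_apply]
  intro i
  rw [← derOfCoord_injective h]
  exact inShiftedDegree_shiftedComponent _ _ _

/-- By Cramer's rule, the determinant of the updated family with respect to `b` is the `t`-th
coordinate of `v`. -/
lemma exists_basis_eq_update [DecidableEq ι] (b : Module.Basis ι (CoordRing K ℓ) M) (v : M) (t : ι)
    (h : IsUnit (b.equivFun v t)) :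
    ∃ b' : Module.Basis ι (CoordRing K ℓ) M, ⇑b' = Function.update b t v := by
  have hdet : b.det (Function.update b t v) = b.equivFun v t := by
    rw [Module.Basis.det_apply, Module.Basis.toMatrix_update, Module.Basis.toMatrix_self,
      ← Matrix.cramer_apply, Matrix.cramer_one]
    rfl
  rw [← hdet, ← Module.Basis.is_basis_iff_det] at h
  exact ⟨Module.Basis.mk h.1 h.2.ge, Module.Basis.coe_mk _ _⟩

open Classical in
/-- The basis elements that are not logarithmic along `ker α`. -/
def nonLogarithmic (α : Module.Dual K (Fin ℓ → K)) (b : Module.Basis ι (CoordRing K ℓ) M) :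
    Finset ι :=
  Finset.univ.filter fun i => ¬ linearPoly α ∣ (b i : Der K ℓ) (linearPoly α)

/-- A homogeneous basis with the least possible number of elements that are not logarithmic
along `ker α`. -/
def IsOptimalBasis (α : Module.Dual K (Fin ℓ → K)) (b : Module.Basis ι (CoordRing K ℓ) M) : Prop :=
  IsHomogeneousBasis b ∧ ∀ b' : Module.Basis ι (CoordRing K ℓ) M, IsHomogeneousBasis b' →
    (nonLogarithmic α b).card ≤ (nonLogarithmic α b').card

lemma exists_isOptimalBasis (α : Module.Dual K (Fin ℓ → K))
    (h : ∃ b : Module.Basis ι (CoordRing K ℓ) M, IsHomogeneousBasis b) :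
    ∃ b : Module.Basis ι (CoordRing K ℓ) M, IsOptimalBasis α b := by
  classical
  have h' : ∃ n, ∃ b : Module.Basis ι (CoordRing K ℓ) M, IsHomogeneousBasis b ∧
      (nonLogarithmic α b).card = n := by
    obtain ⟨b, hb⟩ := h
    exact ⟨_, b, hb, rfl⟩
  obtain ⟨b, hb, hn⟩ := Nat.find_spec h'
  exact ⟨b, hb, fun b' hb' => hn ▸ Nat.find_min' h' ⟨b', hb', rfl⟩⟩

lemma nonLogarithmic_subset_of_eq_update [DecidableEq ι] {α : Module.Dual K (Fin ℓ → K)}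
    {b b' : Module.Basis ι (CoordRing K ℓ) M} {v : M} {t : ι}
    (hv : linearPoly α ∣ (v : Der K ℓ) (linearPoly α)) (h : ⇑b' = Function.update b t v) :
    nonLogarithmic α b' ⊆ (nonLogarithmic α b).erase t := fun i hi => by
  simp only [nonLogarithmic, Finset.mem_erase, Finset.mem_filter, Finset.mem_univ, true_and, h]
    at hi ⊢
  by_cases hit : i = t
  · subst hit
    rw [Function.update_self] at hi
    exact absurd hv hi
  · rw [Function.update_of_ne hit] at hi
    exact ⟨hit, hi⟩

/-- Otherwise the degree-`d t` part of `c`, with its entries at logarithmic basis elements erased,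
would be logarithmic along `ker α` with a unit at `t`. Exchanging it for `b t` would contradict
optimality. -/
lemma IsOptimalBasis.constantCoeff_eq_zero {α : Module.Dual K (Fin ℓ → K)}
    (hb : IsOptimalBasis α b) {c : ι → CoordRing K ℓ}
    (hc : c ∈ relationModule α fun i => (b i : Der K ℓ) (linearPoly α)) {t : ι}
    (ht : ¬ linearPoly α ∣ (b t : Der K ℓ) (linearPoly α)) : constantCoeff (c t) = 0 := by
  classical
  by_contra hct
  choose d hd using hb.1
  let c' : ι → CoordRing K ℓ := fun i =>
    if linearPoly α ∣ (b i : Der K ℓ) (linearPoly α) then 0 else shiftedComponent (d i) (d t) (c i)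
  have hc't : c' t = C (constantCoeff (c t)) := by
    simp only [c', if_neg ht]
    exact shiftedComponent_self _ _
  have hhom : IsHomogeneousVec d (d t) c' := fun i => by
    by_cases hi : linearPoly α ∣ (b i : Der K ℓ) (linearPoly α)
    · exact Or.inl (if_pos hi)
    · simp only [c', if_neg hi]
      exact inShiftedDegree_shiftedComponent _ _ _
  have hdvd : linearPoly α ∣ derOfCoord b c' (linearPoly α) := by
    have h1 := dvd_homogeneousComponent (mem_relationModule.mp hc) (d t)
    rw [map_sum] at h1
    rw [derOfCoord_apply, ← dvd_sub_right h1, ← Finset.sum_sub_distrib]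
    refine Finset.dvd_sum fun i _ => ?_
    rw [homogeneousComponent_mul_of_isHomogeneous ((hd i).apply_linearPoly α), ← sub_mul]
    by_cases hi : linearPoly α ∣ (b i : Der K ℓ) (linearPoly α)
    · exact hi.mul_left _
    · simp [c', if_neg hi]
  obtain ⟨b', hb'⟩ := exists_basis_eq_update b (b.equivFun.symm c') t (by
    rw [LinearEquiv.apply_symm_apply, hc't]
    exact (IsUnit.mk0 _ hct).map C)
  have h1 := hb.2 b' (hb.1.of_eq_update (hhom.isHomogeneousDer hd) hb')
  have h2 := Finset.card_le_card (nonLogarithmic_subset_of_eq_update hdvd hb')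
  have h3 : t ∈ nonLogarithmic α b := by simpa [nonLogarithmic] using ht
  have := Finset.card_erase_lt_of_mem h3
  omega

lemma IsOptimalBasis.reindex {α : Module.Dual K (Fin ℓ → K)} (hb : IsOptimalBasis α b)
    (σ : ι ≃ ι) : IsOptimalBasis α (b.reindex σ) := by
  classical
  refine ⟨fun i => by simpa using hb.1 (σ.symm i), fun b' hb' => ?_⟩
  refine le_trans (le_of_eq ?_) (hb.2 b' hb')
  refine Finset.card_nbij' σ.symm σ ?_ ?_ ?_ ?_ <;>
    simp [nonLogarithmic, Set.MapsTo, Set.LeftInvOn, Set.RightInvOn]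

/-- The Euler derivation of a non-empty arrangement belongs to an optimal basis. -/
lemma IsOptimalBasis.exists_eulerDer {B : Arrangement K ℓ} (hB : B.hyperplanes.Nonempty)
    {α : Module.Dual K (Fin ℓ → K)} {b : Module.Basis ι (CoordRing K ℓ) B.logDer}
    (hb : IsOptimalBasis α b) (j₀ : ι) :
    ∃ b' : Module.Basis ι (CoordRing K ℓ) B.logDer, IsOptimalBasis α b' ∧
      (b' j₀ : Der K ℓ) = eulerDer K ℓ := by
  classical
  obtain ⟨L, hL⟩ := hB
  obtain ⟨β, hβ, rfl⟩ := B.isHyperplane L hL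
  let E : B.logDer := ⟨eulerDer K ℓ, Arrangement.eulerDer_mem_logDer⟩
  choose d hd using hb.1
  choose g hg using fun i => Arrangement.mem_logDer.mp (b i).2 β hL
  have hE : derOfCoord b (b.equivFun E) = eulerDer K ℓ := derOfCoord_equivFun E
  -- This is `θ_E(β) = β` divided by `β`, with `b i (β) = β * g i`. Comparing constant terms, some
  -- coordinate of `θ_E` has a non-zero one.
  have hsum : ∑ i, b.equivFun E i * g i = 1 := by
    have h1 := derOfCoord_apply (b := b) (b.equivFun E) (linearPoly β)
    rw [hE, eulerDer_linearPoly] at h1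
    refine mul_left_cancel₀ (linearPoly_ne_zero hβ) ?_
    rw [mul_one, Finset.mul_sum]
    refine Eq.trans (Finset.sum_congr rfl fun i _ => ?_) h1.symm
    rw [hg]
    ring
  obtain ⟨j, hj⟩ : ∃ j, constantCoeff (b.equivFun E j) ≠ 0 := by
    by_contra! hcon
    have := congrArg constantCoeff hsum
    simp only [map_sum, map_mul, map_one, hcon, zero_mul, Finset.sum_const_zero] at this
    exact zero_ne_one this
  have hhom : IsHomogeneousVec d 1 (b.equivFun E) :=
    IsHomogeneousDer.isHomogeneousVec hd (hE.symm ▸ isHomogeneousDer_eulerDer)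
  -- A homogeneous polynomial with non-zero constant term is a constant.
  have hunit : IsUnit (b.equivFun E j) := by
    rcases hhom j with h0 | ⟨hle, hhomj⟩
    · rw [h0] at hj
      exact absurd (map_zero _) hj
    · have hdeg : 1 - d j = 0 := by
        by_contra hne
        refine hj ?_
        rw [constantCoeff_eq]
        exact hhomj.coeff_eq_zero (by simpa using Ne.symm hne)
      rw [hdeg] at hhomj
      rw [← homogeneousComponent_eq_self hhomj, homogeneousComponent_zero, ← constantCoeff_eq]
      exact (IsUnit.mk0 _ hj).map C
  obtain ⟨b', hb'⟩ := exists_basis_eq_update b E j hunit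
  have hopt : IsOptimalBasis α b' := by
    refine ⟨hb.1.of_eq_update isHomogeneousDer_eulerDer hb', fun b'' hb'' => ?_⟩
    refine le_trans (Finset.card_le_card ?_) (hb.2 b'' hb'')
    refine (nonLogarithmic_subset_of_eq_update ?_ hb').trans (Finset.erase_subset _ _)
    change linearPoly α ∣ eulerDer K ℓ (linearPoly α)
    rw [eulerDer_linearPoly]
  refine ⟨b'.reindex (Equiv.swap j j₀), hopt.reindex _, ?_⟩
  rw [Module.Basis.reindex_apply, Equiv.symm_swap, Equiv.swap_apply_right, hb',
    Function.update_self]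

end Bases

/-! ### `D(A)` as the relation module of a basis of `D(A')` -/

section Restriction

variable {ι : Type*} [Fintype ι] {A : Arrangement K ℓ} {α : Module.Dual K (Fin ℓ → K)}
  {b : Module.Basis ι (CoordRing K ℓ) (A.delete (LinearMap.ker α)).logDer}

lemma derOfCoord_mem_logDer_iff (hα : LinearMap.ker α ∈ A.hyperplanes) {c : ι → CoordRing K ℓ} :
    derOfCoord b c ∈ A.logDer ↔
      c ∈ relationModule α fun i => (b i : Der K ℓ) (linearPoly α) := by
  rw [Arrangement.mem_logDer_iff_delete hα, mem_relationModule, derOfCoord_apply,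
    and_iff_right (derOfCoord_mem c)]

lemma map_derOfCoord_relationModule (hα : LinearMap.ker α ∈ A.hyperplanes) :
    (relationModule α fun i => (b i : Der K ℓ) (linearPoly α)).map (derOfCoord b) = A.logDer := by
  refine le_antisymm ?_ fun θ hθ => ?_
  · rintro _ ⟨c, hc, rfl⟩
    exact (derOfCoord_mem_logDer_iff hα).mpr hc
  · have hθ' := ((Arrangement.mem_logDer_iff_delete hα).mp hθ).1
    have h : derOfCoord b (b.equivFun ⟨θ, hθ'⟩) = θ := derOfCoord_equivFun _
    exact ⟨_, (derOfCoord_mem_logDer_iff hα).mp (h.symm ▸ hθ), h⟩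

/-- For the arrangement with the single hyperplane `ker α`, at most one element of an optimal basis
of `Der S` is not logarithmic. -/
lemma IsOptimalBasis.subsingleton_of_delete_eq_empty (hα : α ≠ 0)
    (hempty : (A.delete (LinearMap.ker α)).hyperplanes = ∅) (hb : IsOptimalBasis α b) {s t : ι}
    (hs : ¬ linearPoly α ∣ (b s : Der K ℓ) (linearPoly α))
    (ht : ¬ linearPoly α ∣ (b t : Der K ℓ) (linearPoly α)) : s = t := by
  classical
  obtain ⟨v, hv⟩ := exists_apply_single_ne_zero hα
  have hmem : pderiv v ∈ (A.delete (LinearMap.ker α)).logDer :=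
    Arrangement.mem_logDer.mpr fun β hβ => by
      rw [hempty] at hβ
      exact hβ.elim
  -- The derivation `pderiv v` is a combination of the `b i` and sends `α` to a non-zero constant.
  obtain ⟨i, hi⟩ : ∃ i, constantCoeff ((b i : Der K ℓ) (linearPoly α)) ≠ 0 := by
    by_contra! hcon
    have h1 := derOfCoord_apply (b := b) (b.equivFun ⟨_, hmem⟩) (linearPoly α)
    rw [derOfCoord_equivFun] at h1
    have h2 := congrArg constantCoeff h1
    simp only [pderiv_linearPoly, constantCoeff_C, map_sum, map_mul, hcon, mul_zero,
      Finset.sum_const_zero] at h2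
    exact hv h2
  have key : ∀ r, ¬ linearPoly α ∣ (b r : Der K ℓ) (linearPoly α) → r = i := fun r hr => by
    by_contra hne
    -- The entry at `r` of this Koszul relation is `b i (α)`, whose constant term is non-zero.
    have := hb.constantCoeff_eq_zero (koszulRelation_mem r i) hr
    rw [Pi.sub_apply, Pi.single_eq_same, Pi.single_eq_of_ne hne, sub_zero] at this
    exact hi this
  rw [key s hs, key t ht]

/-- If the addition of `ker α` to a free arrangement has `ℓ + 1` minimal generators, then exactly
two elements of an optimal basis are not logarithmic along `ker α`. -/
lemma IsOptimalBasis.exists_relation_generator (hα : α ≠ 0)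
    (hαA : LinearMap.ker α ∈ A.hyperplanes) (hb : IsOptimalBasis α b) {d : ι → ℕ}
    (hd : ∀ i, IsHomogeneousDer (b i : Der K ℓ) (d i))
    (hgen : A.HasGenNumber (Fintype.card ι + 1)) :
    ∃ (t₁ t₂ : ι) (e : ℕ) (ψ : ι → CoordRing K ℓ), t₁ ≠ t₂ ∧
      ¬ linearPoly α ∣ (b t₁ : Der K ℓ) (linearPoly α) ∧
      ¬ linearPoly α ∣ (b t₂ : Der K ℓ) (linearPoly α) ∧
      (∀ t, ¬ linearPoly α ∣ (b t : Der K ℓ) (linearPoly α) → t = t₁ ∨ t = t₂) ∧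
      IsHomogeneousVec d e ψ ∧
      ψ ∈ (relationModule α fun i => (b i : Der K ℓ) (linearPoly α)) ∧
      (∀ t, linearPoly α ∣ (b t : Der K ℓ) (linearPoly α) → ψ t = 0) ∧ ¬ linearPoly α ∣ ψ t₁ ∧
      ∀ c ∈ relationModule α fun i => (b i : Der K ℓ) (linearPoly α),
        ∃ p, ∀ t, ¬ linearPoly α ∣ (b t : Der K ℓ) (linearPoly α) →
          linearPoly α ∣ c t - p * ψ t := by
  classical
  obtain ⟨G, ⟨hhom, hspan, hmin⟩, hcard⟩ := hgen
  have hfin : G.Finite :=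
    Set.finite_of_encard_eq_coe (k := Fintype.card ι + 1) (by simpa using hcard)
  have : Fintype G := hfin.fintype
  have hG : Fintype.card G = Fintype.card ι + 1 := by
    rw [Set.encard_eq_coe_toFinset_card, Set.toFinset_card] at hcard
    exact_mod_cast hcard
  have hGmem : ∀ γ : G, (γ : Der K ℓ) ∈ (A.delete (LinearMap.ker α)).logDer := fun γ =>
    ((Arrangement.mem_logDer_iff_delete hαA).mp (hspan ▸ Submodule.subset_span γ.2)).1
  let g : G → ι → CoordRing K ℓ := fun γ => b.equivFun ⟨γ, hGmem γ⟩
  have hg : ∀ γ, derOfCoord b (g γ) = γ := fun γ => derOfCoord_equivFun _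
  choose k hk using fun γ : G => hhom γ γ.2
  refine HypArr.exists_relation_generator (κ := G) (g := g) (k := k) hα
    (fun c hc t ht => hb.constantCoeff_eq_zero hc ht) hG
    (fun γ => IsHomogeneousDer.isHomogeneousVec hd ((hg γ).symm ▸ hk γ)) (fun γ hγ => ?_) ?_
  · have h1 := Submodule.mem_map_of_mem (f := derOfCoord b) hγ
    rw [hg, Submodule.map_span, ← Set.image_comp] at h1
    have h2 : (derOfCoord b ∘ g) '' {γ}ᶜ = G \ {(γ : Der K ℓ)} := by
      ext θ
      constructor
      · rintro ⟨δ, hδ, rfl⟩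
        rw [Function.comp_apply, hg]
        exact ⟨δ.2, fun h => hδ (Subtype.ext h)⟩
      · rintro ⟨hθ, hne⟩
        exact ⟨⟨θ, hθ⟩, fun h => hne (congrArg Subtype.val h), hg ⟨θ, hθ⟩⟩
    rw [h2] at h1
    refine hmin (G \ {(γ : Der K ℓ)}) ⟨Set.sdiff_subset, fun h => (h γ.2).2 rfl⟩ ?_
    rw [← hspan]
    refine le_antisymm (Submodule.span_mono Set.sdiff_subset) (Submodule.span_le.mpr fun θ hθ => ?_)
    by_cases hne : θ = γ
    · rw [hne]
      exact h1
    · exact Submodule.subset_span ⟨hθ, hne⟩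
  · refine Submodule.map_injective_of_injective (derOfCoord_injective (b := b)) ?_
    rw [map_derOfCoord_relationModule hαA, Submodule.map_span, ← Set.range_comp, ← hspan]
    congr 1
    ext θ
    constructor
    · rintro ⟨γ, rfl⟩
      rw [Function.comp_apply, hg]
      exact γ.2
    · intro hθ
      exact ⟨⟨θ, hθ⟩, hg ⟨θ, hθ⟩⟩

end Restriction

/-! ### The resolution of the relation module -/

section Resolution

variable {ι : Type*} [Fintype ι]

/-- The map of the resolution onto the relation module. -/
def resolutionMap (α : Module.Dual K (Fin ℓ → K)) (f ψ : ι → CoordRing K ℓ) :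
    (ι → CoordRing K ℓ) × CoordRing K ℓ →ₗ[CoordRing K ℓ] (ι → CoordRing K ℓ) :=
  (Fintype.linearCombination (CoordRing K ℓ) (trivialRelation α f)).coprod
    (LinearMap.toSpanSingleton (CoordRing K ℓ) _ ψ)

variable {α : Module.Dual K (Fin ℓ → K)} {f ψ : ι → CoordRing K ℓ}

lemma resolutionMap_apply (c : ι → CoordRing K ℓ) (q : CoordRing K ℓ) (i : ι) :
    resolutionMap α f ψ (c, q) i = c i * trivialRelation α f i i + q * ψ i := by
  rw [← sum_smul_trivialRelation]
  rfl

lemma resolutionMap_single [DecidableEq ι] (i : ι) :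
    resolutionMap α f ψ (Pi.single i 1, 0) = trivialRelation α f i := by
  simp [resolutionMap, Fintype.linearCombination_apply_single]

lemma resolutionMap_level : resolutionMap α f ψ (0, 1) = ψ := by
  simp [resolutionMap]

lemma resolutionMap_mem (hψ : ψ ∈ relationModule α f)
    (x : (ι → CoordRing K ℓ) × CoordRing K ℓ) : resolutionMap α f ψ x ∈ relationModule α f := by
  rw [resolutionMap, LinearMap.coprod_apply, Fintype.linearCombination_apply]
  exact add_mem (Submodule.sum_mem _ fun i _ => Submodule.smul_mem _ _ (trivialRelation_mem i))
    (Submodule.smul_mem _ _ hψ)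

lemma exists_resolutionMap_eq
    (hmod : ∀ c ∈ relationModule α f, ∃ p, ∀ t, ¬ linearPoly α ∣ f t → linearPoly α ∣ c t - p * ψ t)
    {c : ι → CoordRing K ℓ} (hc : c ∈ relationModule α f) :
    ∃ x, resolutionMap α f ψ x = c := by
  obtain ⟨p, hp⟩ := hmod c hc
  have h := mem_span_trivialRelation (α := α) (f := f) (c := c - p • ψ) hp
  obtain ⟨q, hq⟩ := (Submodule.mem_span_range_iff_exists_fun _).mp h
  refine ⟨(q, p), ?_⟩
  rw [resolutionMap, LinearMap.coprod_apply, Fintype.linearCombination_apply, hq]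
  exact sub_add_cancel _ _

/-- At `t₁` the equation reads `c t₁ * α + q * ψ t₁ = 0`, so primality gives `q = α * p`. Cancelling
`α` in the other non-logarithmic entries determines `c`. -/
lemma resolutionMap_eq_zero_iff (hα : α ≠ 0) (hψ : ∀ t, linearPoly α ∣ f t → ψ t = 0) {t₁ : ι}
    (ht₁ : ¬ linearPoly α ∣ ψ t₁) (x : (ι → CoordRing K ℓ) × CoordRing K ℓ) :
    resolutionMap α f ψ x = 0 ↔ ∃ p : CoordRing K ℓ, p • (-ψ, linearPoly α) = x := by
  obtain ⟨c, q⟩ := x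
  constructor
  · intro h
    have hft₁ : ¬ linearPoly α ∣ f t₁ := fun h' => ht₁ (hψ t₁ h' ▸ dvd_zero _)
    have h1 : ∀ i, c i * trivialRelation α f i i + q * ψ i = 0 := fun i => by
      rw [← resolutionMap_apply, h, Pi.zero_apply]
    have hq : linearPoly α ∣ q := by
      have h2 := h1 t₁
      rw [trivialRelation_self_of_not_dvd hft₁] at h2
      refine ((prime_linearPoly hα).dvd_or_dvd
        ((dvd_add_right (dvd_mul_left _ (c t₁))).mp ?_)).resolve_right ht₁
      rw [h2]
      exact dvd_zero _
    obtain ⟨p, rfl⟩ := hq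
    refine ⟨p, Prod.ext (funext fun i => ?_) (mul_comm _ _)⟩
    change p * -ψ i = c i
    have h2 := h1 i
    by_cases hi : linearPoly α ∣ f i
    · rw [hψ i hi, trivialRelation_self_of_dvd hi] at h2
      rw [hψ i hi]
      linear_combination -h2
    · rw [trivialRelation_self_of_not_dvd hi] at h2
      refine mul_left_cancel₀ (linearPoly_ne_zero hα) ?_
      linear_combination -h2
  · rintro ⟨p, hp⟩
    rw [← hp, map_smul]
    refine smul_eq_zero_of_right _ (funext fun i => ?_)
    rw [resolutionMap_apply, Pi.neg_apply, Pi.zero_apply]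
    by_cases hi : linearPoly α ∣ f i
    · rw [hψ i hi]
      ring
    · rw [trivialRelation_self_of_not_dvd hi]
      ring

end Resolution

lemma IsHomogeneousDer.eq_one_of_eq_eulerDer {d : ℕ} (hℓ : 0 < ℓ)
    (h : IsHomogeneousDer (eulerDer K ℓ) d) : d = 1 :=
  (h ⟨0, hℓ⟩).inj_right (isHomogeneousDer_eulerDer ⟨0, hℓ⟩) (by
    rw [eulerDer, mkDerivation_X]
    exact X_ne_zero _)

end HypArr

end

/-! ### Assembling the minimal free resolution -/

theorem corollary3p6 {K : Type*} [Field K] {ℓ : ℕ} (A : HypArr.Arrangement K ℓ)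
    (H : Submodule K (Fin ℓ → K)) (hH : H ∈ A.hyperplanes)
    (hfree : (A.delete H).IsFree) (hgen : A.HasGenNumber (ℓ + 1)) :
    A.IsSPOG := by
  classical
  open HypArr in
  obtain ⟨α, hα, rfl⟩ := A.isHyperplane H hH
  have hgen' : A.HasGenNumber (Fintype.card (Fin ℓ) + 1) := by rwa [Fintype.card_fin]
  obtain ⟨b₀, hb₀⟩ := exists_isOptimalBasis (ι := Fin ℓ) α (by
    obtain ⟨d, b, hb⟩ := hfree
    exact ⟨b, fun i => ⟨d i, hb i⟩⟩)
  have hne : (A.delete (LinearMap.ker α)).hyperplanes.Nonempty := by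
    rw [Set.nonempty_iff_ne_empty]
    intro hempty
    choose d hd using hb₀.1
    obtain ⟨t₁, t₂, _, _, hne, ht₁, ht₂, _⟩ := hb₀.exists_relation_generator hα hH hd hgen'
    exact hne (hb₀.subsingleton_of_delete_eq_empty hα hempty ht₁ ht₂)
  have hℓ : 0 < ℓ := by
    obtain ⟨v, _⟩ := exists_apply_single_ne_zero hα
    exact v.pos
  obtain ⟨b, hb, hbE⟩ := hb₀.exists_eulerDer hne ⟨0, hℓ⟩
  choose d hd using hb.1
  obtain ⟨t₁, t₂, e, ψ, -, -, -, -, hψhom, hψN, hψ0, hψ₁, hmod⟩ :=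
    hb.exists_relation_generator hα hH hd hgen'
  set f : Fin ℓ → CoordRing K ℓ := fun i => (b i : Der K ℓ) (linearPoly α) with hf
  have hπ : ∀ x, (derOfCoord b ∘ₗ resolutionMap α f ψ) x ∈ A.logDer := fun x =>
    (derOfCoord_mem_logDer_iff hH).mpr (resolutionMap_mem hψN x)
  have hfE : linearPoly α ∣ f ⟨0, hℓ⟩ := by
    rw [hf]
    simp only [hbE, eulerDer_linearPoly, dvd_refl]
  have hdE : d ⟨0, hℓ⟩ = 1 :=
    IsHomogeneousDer.eq_one_of_eq_eulerDer hℓ (hbE ▸ hd ⟨0, hℓ⟩)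
  refine ⟨fun i => if linearPoly α ∣ f i then d i else d i + 1, e,
    LinearMap.toSpanSingleton (CoordRing K ℓ) _ (-ψ, linearPoly α),
    LinearMap.codRestrict A.logDer (derOfCoord b ∘ₗ resolutionMap α f ψ) hπ,
    ?_, ?_, ?_, ?_, ?_, ?_, ?_, ?_, ?_, ?_, hℓ, ?_, ?_⟩
  · intro p q hpq
    exact mul_right_cancel₀ (linearPoly_ne_zero hα) (congrArg Prod.snd hpq)
  · intro x
    rw [← Submodule.coe_eq_zero, LinearMap.codRestrict_apply, LinearMap.comp_apply,
      map_eq_zero_iff _ derOfCoord_injective, resolutionMap_eq_zero_iff hα hψ0 hψ₁]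
    rfl
  · rintro ⟨θ, hθ⟩
    rw [← map_derOfCoord_relationModule (b := b) hH] at hθ
    obtain ⟨c, hc, hcθ⟩ := hθ
    obtain ⟨x, hx⟩ := exists_resolutionMap_eq hmod hc
    exact ⟨x, Subtype.ext (by rw [LinearMap.codRestrict_apply, LinearMap.comp_apply, hx, hcθ])⟩
  · intro i
    rw [LinearMap.codRestrict_apply, LinearMap.comp_apply, resolutionMap_single]
    convert IsHomogeneousVec.isHomogeneousDer hd (isHomogeneousVec_trivialRelation d i)
  · rw [LinearMap.codRestrict_apply, LinearMap.comp_apply, resolutionMap_level]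
    exact hψhom.isHomogeneousDer hd
  · intro i
    rw [LinearMap.toSpanSingleton_apply_one]
    by_cases hi : linearPoly α ∣ f i
    · exact Or.inl (by simp [hψ0 i hi])
    · simp only [if_neg hi]
      -- The generator `α • b i` has degree `d i + 1` and the relation degree `e + 1`, so the entry
      -- `-ψ i` keeps degree `e - d i`.
      exact ((hψhom i).shift 1).neg
  · rw [LinearMap.toSpanSingleton_apply_one]
    refine Or.inr ⟨by omega, ?_⟩
    rw [Nat.add_sub_cancel_left]
    exact isHomogeneous_linearPoly α
  · intro i
    rw [LinearMap.toSpanSingleton_apply_one]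
    change constantCoeff (-ψ i) = 0
    by_cases hi : linearPoly α ∣ f i
    · rw [hψ0 i hi, neg_zero, map_zero]
    · rw [map_neg, hb.constantCoeff_eq_zero hψN hi, neg_zero]
  · rw [LinearMap.toSpanSingleton_apply_one]
    exact constantCoeff_linearPoly α
  · rw [LinearMap.toSpanSingleton_apply_one]
    exact linearPoly_ne_zero hα
  · simp only [if_pos hfE, hdE]
  · rw [LinearMap.codRestrict_apply, LinearMap.comp_apply, resolutionMap_single, trivialRelation,
      if_pos hfE]
    convert (derOfCoord_single (b := b) ⟨0, hℓ⟩ 1).trans (by rw [one_smul, hbE])
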